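/- Let $p_1,p_2,p_3$ be pairwise coprime positive integers. Let $\mathcal S=\mathcal S_{p_1,p_2,p_3}$ be the orbit space of the action of $S^1$ on $SU(3)$ $$z:\ A\mapsto \mathrm{diag}(z^{p_1},z^{p_2},z^{p_3})\,A\,\mathrm{diag}(1,1,z^{-p_1-p_2-p_3}),$$ a $3$-Sasakian manifold whose characteristic fields are the Killing fields of the (right) action of $SU(2)$ on $\mathcal S$ induced by $B: A\mapsto A\begin{pmatrix}B&0\\0&1\end{pmatrix}$. Let the twistor space $\mathcal Z=\mathcal Z_{p_1,p_2,p_3}$ be the orbit space of $\mathcal S$ under the circle generated by the first characteristic field, that is, under the action of the circle subgroup $\{\mathrm{diag}(u,u^{-1})\}\subset SU(2)$. Orbit spaces carry the quotient topology and the quotient smooth structure: a map from $\mathbb R^k$ into an orbit space $X/G$ is smooth if it lifts locally to a smooth map into $X$. A diffeomorphism is a homeomorphism $\Phi$ such that $\Phi$ and $\Phi^{-1}$ send smooth maps from the spaces $\mathbb R^k$ to smooth maps (for the orbifolds below this is the notion of a diffeomorphism of orbifolds). Then: 1. $\mathcal Z$ is diffeomorphic to the orbit space of the action of $T^2$ on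 $SU(3)$ $$(z,u):\ A\mapsto \mathrm{diag}(z^{p_1},z^{p_2},z^{p_3})\,A\,\mathrm{diag}(u,u^{-1},z^{-p_1-p_2-p_3}).$$ 2. $\mathcal Z$ is diffeomorphic to the orbit space of the action of $T^3$ on $U(3)$ $$(z,u,v):\ A\mapsto \mathrm{diag}(z^{-p_2-p_3},z^{-p_1-p_3},z^{-p_1-p_2})\,A\,\mathrm{diag}(u,v,1).$$ -/

import Mathlib

open scoped ContDiff

noncomputable section

namespace TwistorSpace

/-- The Lie group `U(3)`. -/
abbrev U3 : Type := Matrix.unitaryGroup (Fin 3) ℂ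

/-- The Lie group `SU(3)`. -/
abbrev SU3 : Type := Matrix.specialUnitaryGroup (Fin 3) ℂ

/-- The Lie group `SU(2)`. -/
abbrev SU2 : Type := Matrix.specialUnitaryGroup (Fin 2) ℂ

/-- The smooth structure that a group of complex matrices inherits from the matrix space
(the subspace diffeology): a map `ℝᵏ → M` is smooth if and only if its matrix entries are.
For the closed embedded submanifolds `SU(3)` and `U(3)` this is the usual smooth structure. -/
instance matrixDiffeology {n : ℕ} (M : Submonoid (Matrix (Fin n) (Fin n) ℂ)) :
    DiffeologicalSpace M :=
  .ofCorePlotsOn {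
    isPlotOn := fun {_ u} _ p => ∀ i j, ContDiffOn ℝ ∞ (fun x => (p x).1 i j) u
    isPlotOn_congr := fun {_ u} _ p q h => by
      refine forall_congr' fun i => forall_congr' fun j => contDiffOn_congr fun x hx => ?_
      rw [h hx]
    isPlot_const := fun _ _ _ => contDiffOn_const
    isPlotOn_reparam := fun {_ _ u v hu} hv p f h hp hf i j =>
      (hp i j).comp hf h
    locality := fun {_ u} hu p h i j x hx => by
      obtain ⟨v, hv, hxv, hpv⟩ := h x hx
      exact ((hpv i j x hxv).contDiffAt (hv.mem_nhds hxv)).contDiffWithinAt }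

/-- The orbit space `X / G` of a group action. -/
def OrbitSpace {G X : Type} [Group G] (act : MulAction G X) : Type :=
  Quotient (@MulAction.orbitRel G X _ act)

namespace OrbitSpace

variable {G X : Type} [Group G]

/-- The projection onto the orbit space. -/
def mk (act : MulAction G X) (x : X) : OrbitSpace act :=
  Quotient.mk (@MulAction.orbitRel G X _ act) x

/-- The quotient topology. -/
instance [TopologicalSpace X] (act : MulAction G X) : TopologicalSpace (OrbitSpace act) :=
  TopologicalSpace.coinduced (mk act) inferInstance

/-- The quotient smooth structure (quotient diffeology), which is generated by the composites of
the smooth maps `ℝᵏ → X` with the projection `X → X / G`: a map `ℝᵏ → X / G` is smooth if and only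
if it lifts locally to a smooth map into `X`. For a free action of a compact Lie group on a manifold
this is the usual quotient manifold, and for a locally free one the usual quotient orbifold. -/
instance [DiffeologicalSpace X] (act : MulAction G X) : DiffeologicalSpace (OrbitSpace act) :=
  DiffeologicalSpace.generateFrom
    {q | ∃ p : EuclideanSpace ℝ (Fin q.1) → X, Diffeology.IsPlot p ∧ q.2 = mk act ∘ p}

end OrbitSpace

/-- Two spaces are diffeomorphic if there is a homeomorphism between them that is smooth in both
directions. -/
def Diffeomorphic (X Y : Type) [TopologicalSpace X] [DiffeologicalSpace X]
    [TopologicalSpace Y] [DiffeologicalSpace Y] : Prop :=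
  ∃ Φ : X ≃ₜ Y, Diffeology.DSmooth Φ ∧ Diffeology.DSmooth Φ.symm

/-- The diagonal matrix `diag(a, b, c)` with entries in the unit circle, as an element of `U(3)`. -/
def diag3 (a b c : Circle) : U3 :=
  ⟨Matrix.diagonal ![(a : ℂ), (b : ℂ), (c : ℂ)], by
    rw [Matrix.mem_unitaryGroup_iff, Matrix.star_eq_conjTranspose, Matrix.diagonal_conjTranspose,
      Matrix.diagonal_mul_diagonal, ← Matrix.diagonal_one]
    congr 1
    funext i
    fin_cases i <;> simp [Complex.mul_conj]⟩

theorem diag3_mul (a b c a' b' c' : Circle) :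
    diag3 (a * a') (b * b') (c * c') = diag3 a b c * diag3 a' b' c' := by
  apply Subtype.ext
  simp only [diag3, Matrix.UnitaryGroup.mul_val, Matrix.diagonal_mul_diagonal]
  congr 1
  funext i
  fin_cases i <;> simp

theorem diag3_one : diag3 1 1 1 = 1 := by
  apply Subtype.ext
  simp only [diag3, Matrix.UnitaryGroup.one_val, ← Matrix.diagonal_one]
  congr 1
  funext i
  fin_cases i <;> simp

theorem det_diag3 (a b c : Circle) :
    (diag3 a b c).1.det = ((a * b * c : Circle) : ℂ) := by
  simp [diag3, Matrix.det_diagonal, Fin.prod_univ_three]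

/-- For `abca'b'c' = 1`, the matrix `diag(a, b, c) * A * diag(a', b', c')` of `SU(3)`. -/
def twoSided (a b c a' b' c' : Circle) (h : a * b * c * (a' * b' * c') = 1) (A : SU3) : SU3 :=
  ⟨(diag3 a b c).1 * A.1 * (diag3 a' b' c').1, by
    have hA := Matrix.mem_specialUnitaryGroup_iff.1 A.2
    refine Matrix.mem_specialUnitaryGroup_iff.2
      ⟨mul_mem (mul_mem (diag3 a b c).2 hA.1) (diag3 a' b' c').2, ?_⟩
    rw [Matrix.det_mul, Matrix.det_mul, det_diag3, det_diag3, hA.2, mul_one, ← Circle.coe_mul, h,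
      Circle.coe_one]⟩

theorem diag3_mul_mul (a b c d e f a' b' c' d' e' f' : Circle) (A : Matrix (Fin 3) (Fin 3) ℂ) :
    (diag3 (a * a') (b * b') (c * c')).1 * A * (diag3 (d * d') (e * e') (f * f')).1 =
      (diag3 a b c).1 * ((diag3 a' b' c').1 * A * (diag3 d' e' f').1) * (diag3 d e f).1 := by
  rw [mul_comm d, mul_comm e, mul_comm f, diag3_mul, diag3_mul, Matrix.UnitaryGroup.mul_val,
    Matrix.UnitaryGroup.mul_val]
  simp only [mul_assoc]

/-- The action `z : A ↦ diag(z^p₁, z^p₂, z^p₃) * A * diag(1, 1, z^(-p₁-p₂-p₃))` of `S¹` on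
`SU(3)`. -/
@[reducible]
def sasakianAction (p₁ p₂ p₃ : ℤ) : MulAction Circle SU3 where
  smul z A := twoSided (z ^ p₁) (z ^ p₂) (z ^ p₃) 1 1 (z ^ (-p₁ - p₂ - p₃))
    (by simp only [one_mul, ← zpow_add]; ring_nf; simp) A
  one_smul A := Subtype.ext (by
    change (diag3 _ _ _).1 * A.1 * (diag3 _ _ _).1 = A.1
    simp [diag3_one])
  mul_smul z w A := Subtype.ext (by
    change (diag3 _ _ _).1 * A.1 * (diag3 _ _ _).1 =
      (diag3 _ _ _).1 * ((diag3 _ _ _).1 * A.1 * (diag3 _ _ _).1) * (diag3 _ _ _).1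
    simp only [mul_zpow, ← diag3_mul_mul, mul_one])

/-- The 3-Sasakian orbit space `𝒮 = SU(3) / S¹`. -/
abbrev Sasakian (p₁ p₂ p₃ : ℤ) : Type := OrbitSpace (sasakianAction p₁ p₂ p₃)

/-- The inclusion of `SU(2)` into `SU(3)` as the upper left block. -/
def blockSU2 : SU2 →* SU3 where
  toFun B := ⟨!![B.1 0 0, B.1 0 1, 0; B.1 1 0, B.1 1 1, 0; 0, 0, 1], by
    have hB := Matrix.mem_specialUnitaryGroup_iff.1 B.2
    have h1 := Matrix.mem_unitaryGroup_iff.1 hB.1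
    have h2 := hB.2
    have h00 := congrFun (congrFun h1 0) 0
    have h01 := congrFun (congrFun h1 0) 1
    have h10 := congrFun (congrFun h1 1) 0
    have h11 := congrFun (congrFun h1 1) 1
    simp only [Matrix.mul_apply, Fin.sum_univ_two, Matrix.star_apply, Matrix.one_apply_eq, ne_eq,
      zero_ne_one, one_ne_zero, not_false_eq_true, Matrix.one_apply_ne] at h00 h01 h10 h11
    rw [Matrix.det_fin_two] at h2
    refine Matrix.mem_specialUnitaryGroup_iff.2 ⟨Matrix.mem_unitaryGroup_iff.2 ?_, ?_⟩
    · ext i j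
      fin_cases i <;> fin_cases j <;>
        simp [Matrix.mul_apply, Fin.sum_univ_three] <;> assumption
    · simpa [Matrix.det_fin_three] using h2⟩
  map_one' := Subtype.ext (by
    ext i j
    fin_cases i <;> fin_cases j <;> simp)
  map_mul' B C := Subtype.ext (by
    ext i j
    fin_cases i <;> fin_cases j <;>
      simp [Matrix.mul_apply, Fin.sum_univ_two])

theorem diag3_mul_blockSU2 (w : Circle) (B : SU2) :
    (diag3 1 1 w).1 * (blockSU2 B).1 = (blockSU2 B).1 * (diag3 1 1 w).1 := by
  ext i j
  fin_cases i <;> fin_cases j <;>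
    simp [diag3, blockSU2, Matrix.diagonal_mul, Matrix.mul_diagonal]

/-- The action of `SU(2)` on `𝒮` induced by the right translations `B : A ↦ A * diag(B, 1)`,
a right action. Its Killing fields are the characteristic fields of `𝒮`. -/
@[reducible]
def su2Action (p₁ p₂ p₃ : ℤ) : MulAction SU2ᵐᵒᵖ (Sasakian p₁ p₂ p₃) where
  smul B := Quotient.map' (fun A => A * blockSU2 B.unop) (by
    rintro A A' ⟨z, hz⟩
    refine ⟨z, Subtype.ext ?_⟩
    have hz' : (diag3 _ _ _).1 * A'.1 * (diag3 _ _ _).1 = A.1 := congrArg Subtype.val hz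
    change (diag3 _ _ _).1 * (A'.1 * (blockSU2 B.unop).1) * (diag3 _ _ _).1 =
      A.1 * (blockSU2 B.unop).1
    rw [← hz', mul_assoc, mul_assoc, ← diag3_mul_blockSU2]
    simp only [mul_assoc])
  one_smul := by
    rintro ⟨A⟩
    change OrbitSpace.mk _ (A * blockSU2 1) = OrbitSpace.mk _ A
    rw [map_one, mul_one]
  mul_smul B C := by
    rintro ⟨A⟩
    change OrbitSpace.mk _ (A * blockSU2 (C.unop * B.unop)) =
      OrbitSpace.mk _ (A * blockSU2 C.unop * blockSU2 B.unop)
    rw [map_mul, mul_assoc]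

/-- The maximal torus `u ↦ diag(u, u⁻¹)` of `SU(2)`. -/
def torusSU2 : Circle →* SU2 where
  toFun u := ⟨!![(u : ℂ), 0; 0, ((u⁻¹ : Circle) : ℂ)], by
    refine Matrix.mem_specialUnitaryGroup_iff.2 ⟨Matrix.mem_unitaryGroup_iff.2 ?_, ?_⟩
    · ext i j
      fin_cases i <;> fin_cases j <;>
        simp [Matrix.mul_apply, Fin.sum_univ_two, Complex.mul_conj, ← Circle.coe_inv_eq_conj]
    · simp [Matrix.det_fin_two]⟩
  map_one' := Subtype.ext (by
    ext i j
    fin_cases i <;> fin_cases j <;> simp)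
  map_mul' u v := Subtype.ext (by
    ext i j
    fin_cases i <;> fin_cases j <;>
      simp [mul_comm])

/-- The circle action on `𝒮` generated by the characteristic field `ξ¹`. -/
@[reducible]
def characteristicAction (p₁ p₂ p₃ : ℤ) : MulAction Circle (Sasakian p₁ p₂ p₃) where
  smul u x := (su2Action p₁ p₂ p₃).smul (MulOpposite.op (torusSU2 u)) x
  one_smul x := by
    change (su2Action p₁ p₂ p₃).smul (MulOpposite.op (torusSU2 1)) x = x
    rw [map_one]
    exact (su2Action p₁ p₂ p₃).one_smul x
  mul_smul u v x := by
    change (su2Action p₁ p₂ p₃).smul (MulOpposite.op (torusSU2 (u * v))) x = _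
    rw [mul_comm, map_mul, MulOpposite.op_mul]
    exact (su2Action p₁ p₂ p₃).mul_smul _ _ x

/-- The twistor space `𝒵 = 𝒮 / S¹` of `𝒮`. -/
abbrev Twistor (p₁ p₂ p₃ : ℤ) : Type := OrbitSpace (characteristicAction p₁ p₂ p₃)

/-- The action
`(z, u) : A ↦ diag(z^p₁, z^p₂, z^p₃) * A * diag(u, u⁻¹, z^(-p₁-p₂-p₃))` of `T²` on `SU(3)`. -/
@[reducible]
def torus2Action (p₁ p₂ p₃ : ℤ) : MulAction (Circle × Circle) SU3 where
  smul := fun (z, u) A => twoSided (z ^ p₁) (z ^ p₂) (z ^ p₃) u u⁻¹ (z ^ (-p₁ - p₂ - p₃))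
    (by simp only [mul_inv_cancel, one_mul, ← zpow_add]; ring_nf; simp) A
  one_smul A := Subtype.ext (by
    change (diag3 _ _ _).1 * A.1 * (diag3 _ _ _).1 = A.1
    simp [diag3_one])
  mul_smul := fun (z, u) (w, v) A => Subtype.ext (by
    change (diag3 _ _ _).1 * A.1 * (diag3 _ _ _).1 =
      (diag3 _ _ _).1 * ((diag3 _ _ _).1 * A.1 * (diag3 _ _ _).1) * (diag3 _ _ _).1
    simp only [mul_zpow, mul_inv, ← diag3_mul_mul])

/-- The action
`(z, u, v) : A ↦ diag(z^(-p₂-p₃), z^(-p₁-p₃), z^(-p₁-p₂)) * A * diag(u, v, 1)` of `T³` on `U(3)`. -/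
@[reducible]
def torus3Action (p₁ p₂ p₃ : ℤ) : MulAction (Circle × Circle × Circle) U3 where
  smul := fun (z, u, v) A =>
    diag3 (z ^ (-p₂ - p₃)) (z ^ (-p₁ - p₃)) (z ^ (-p₁ - p₂)) * A * diag3 u v 1
  one_smul A := by
    change diag3 _ _ _ * A * diag3 _ _ _ = A
    simp [diag3_one]
  mul_smul := fun (z, u, v) (z', u', v') A => Subtype.ext (by
    change (diag3 _ _ _).1 * A.1 * (diag3 _ _ _).1 =
      (diag3 _ _ _).1 * ((diag3 _ _ _).1 * A.1 * (diag3 _ _ _).1) * (diag3 _ _ _).1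
    simp only [mul_zpow, ← diag3_mul_mul, mul_one])

end TwistorSpace

end

/-! All three spaces are quotients of `SU3` or `U3`, so it suffices to compare fibres upstairs and
then descend (`IsSmoothQuotientMap.diffeomorphic`). The composite projection of `SU3` onto the
twistor space has the `T²`-orbits as fibres (`twistorMk_eq_iff`), so the identity of `SU3` induces
the first diffeomorphism. For the second, scalar matrices are central, and pulling `z^(-p₁-p₂-p₃)`
from left to right turns the `T³`-action into `diag(z^p₁, z^p₂, z^p₃) * A * diag(su, sv, s)` with `s
= z^(-p₁-p₂-p₃)`. Between matrices of determinant one this forces `su * sv = 1`, which is a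
`T²`-translation (`torus3_mk_inclU3_eq_iff`). Every `T³`-orbit meets `SU3`, through the smooth
retraction `retractSU3`. Inclusion and retraction thus descend to mutually inverse maps. -/

namespace TwistorSpace

open Diffeology

/-! ### Smooth quotient maps -/

/-- A map `π : X → Q` is a smooth quotient map if `Q` carries both the quotient topology and the
quotient diffeology of `X`. -/
structure IsSmoothQuotientMap {X Q : Type} [TopologicalSpace X] [DiffeologicalSpace X]
    [TopologicalSpace Q] [DiffeologicalSpace Q] (π : X → Q) : Prop where
  isQuotientMap : Topology.IsQuotientMap π
  dSmooth : DSmooth π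
  dSmooth_of_comp : ∀ {Z : Type} [DiffeologicalSpace Z] {f : Q → Z}, DSmooth (f ∘ π) → DSmooth f

namespace IsSmoothQuotientMap

variable {X Y Q R : Type} [TopologicalSpace X] [DiffeologicalSpace X]
  [TopologicalSpace Y] [DiffeologicalSpace Y] [TopologicalSpace Q] [DiffeologicalSpace Q]
  [TopologicalSpace R] [DiffeologicalSpace R]

/-- Lets the twistor space, a quotient of a quotient, be treated as a single quotient of `SU3`. -/
theorem comp {π : X → Q} {ρ : Q → R} (hρ : IsSmoothQuotientMap ρ) (hπ : IsSmoothQuotientMap π) :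
    IsSmoothQuotientMap (ρ ∘ π) where
  isQuotientMap := hρ.isQuotientMap.comp hπ.isQuotientMap
  dSmooth := hρ.dSmooth.comp hπ.dSmooth
  dSmooth_of_comp h := hρ.dSmooth_of_comp (hπ.dSmooth_of_comp h)

/-- Two smooth quotients of `X` and `Y` are diffeomorphic as soon as a smooth map `X → Y` preserves
and reflects the fibres of the projections, and has a smooth section up to these fibres. -/
theorem diffeomorphic {π : X → Q} {ρ : Y → R} (hπ : IsSmoothQuotientMap π)
    (hρ : IsSmoothQuotientMap ρ) {f : X → Y} {g : Y → X} (hf : Continuous f) (hf' : DSmooth f)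
    (hg : Continuous g) (hg' : DSmooth g) (hfib : ∀ x x', ρ (f x) = ρ (f x') ↔ π x = π x')
    (hfg : ∀ y, ρ (f (g y)) = ρ y) : Diffeomorphic Q R := by
  have hsπ := Function.surjInv_eq hπ.isQuotientMap.surjective
  have hsρ := Function.surjInv_eq hρ.isQuotientMap.surjective
  -- The sections are arbitrary choices; regularity of `F` and `G` comes only from `hF` and `hG`,
  -- which show that the choices do not matter.
  let F : Q → R := fun q => ρ (f (Function.surjInv hπ.isQuotientMap.surjective q))
  let G : R → Q := fun r => π (g (Function.surjInv hρ.isQuotientMap.surjective r))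
  have hF : ∀ x, F (π x) = ρ (f x) := fun x => (hfib _ _).2 (hsπ _)
  have hG : ∀ y, G (ρ y) = π (g y) := fun y =>
    (hfib _ _).1 (by rw [hfg, hfg, hsρ])
  have hFπ : F ∘ π = ρ ∘ f := funext hF
  have hGρ : G ∘ ρ = π ∘ g := funext hG
  refine ⟨⟨⟨F, G, fun q => ?_, fun r => ?_⟩, ?_, ?_⟩, ?_, ?_⟩
  · obtain ⟨x, rfl⟩ := hπ.isQuotientMap.surjective q
    rw [hF, hG]
    exact (hfib _ _).1 (hfg _)
  · obtain ⟨y, rfl⟩ := hρ.isQuotientMap.surjective r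
    rw [hG, hF, hfg]
  · exact hπ.isQuotientMap.continuous_iff.2 (hFπ ▸ hρ.isQuotientMap.continuous.comp hf)
  · exact hρ.isQuotientMap.continuous_iff.2 (hGρ ▸ hπ.isQuotientMap.continuous.comp hg)
  · exact hπ.dSmooth_of_comp (hFπ ▸ hρ.dSmooth.comp hf' : DSmooth (F ∘ π))
  · exact hρ.dSmooth_of_comp (hGρ ▸ hπ.dSmooth.comp hg' : DSmooth (G ∘ ρ))

end IsSmoothQuotientMap

namespace OrbitSpace

variable {G X : Type} [Group G]

theorem mk_eq_mk_iff {act : MulAction G X} {x y : X} :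
    mk act x = mk act y ↔ ∃ g : G, act.smul g y = x :=
  Quotient.eq (r := @MulAction.orbitRel G X _ act)

theorem isSmoothQuotientMap_mk [TopologicalSpace X] [DiffeologicalSpace X] (act : MulAction G X) :
    IsSmoothQuotientMap (mk act) where
  isQuotientMap := ⟨⟨rfl⟩, Quotient.mk_surjective⟩
  dSmooth _ p hp := DiffeologicalSpace.isPlot_generatedFrom_of_mem ⟨p, hp, rfl⟩
  dSmooth_of_comp {Z} dZ f hf := by
    -- The pullback diffeology along `f`. It contains the generating plots, hence every plot of the
    -- generated diffeology.
    let d : DiffeologicalSpace (OrbitSpace act) :=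
      { plots := fun _ => {q | IsPlot (f ∘ q)}
        constant_plots := fun _ => isPlot_const
        plot_reparam := fun hp hφ => isPlot_reparam hp hφ
        locality := fun h => dZ.locality h }
    intro n q hq
    refine hq d ?_
    rintro ⟨m, r⟩ ⟨p, hp, hr⟩
    change r = mk act ∘ p at hr
    change IsPlot (f ∘ r)
    rw [hr]
    exact hf m p hp

end OrbitSpace

/-! ### Matrix groups -/

theorem isPlot_matrix_iff {n k : ℕ} {M : Submonoid (Matrix (Fin n) (Fin n) ℂ)}
    {p : EuclideanSpace ℝ (Fin k) → M} :
    IsPlot p ↔ ∀ i j, ContDiff ℝ ∞ fun x => (p x).1 i j :=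
  forall₂_congr fun _ _ => contDiffOn_univ

theorem blockSU2_torusSU2 (u : Circle) : (blockSU2 (torusSU2 u)).1 = (diag3 u u⁻¹ 1).1 := by
  ext i j
  fin_cases i <;> fin_cases j <;> simp [diag3, blockSU2, torusSU2]

/-- The inclusion of `SU(3)` into `U(3)`. -/
def inclU3 (A : SU3) : U3 :=
  ⟨A.1, (Matrix.mem_specialUnitaryGroup_iff.1 A.2).1⟩

theorem continuous_inclU3 : Continuous inclU3 :=
  continuous_subtype_val.subtype_mk _

theorem dSmooth_inclU3 : DSmooth inclU3 :=
  fun _ _ hp => isPlot_matrix_iff.2 (isPlot_matrix_iff.1 hp)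

/-- The determinant of a unitary matrix, as an element of the unit circle. -/
def detU3 (A : U3) : Circle :=
  ⟨A.1.det, mem_sphere_zero_iff_norm.2
    (CStarRing.norm_of_mem_unitary (Matrix.det_of_mem_unitary A.2))⟩

/-- The retraction `A ↦ A * diag(1, (det A)⁻¹, 1)` of `U(3)` onto `SU(3)`. -/
noncomputable def retractSU3 (A : U3) : SU3 :=
  ⟨A.1 * (diag3 1 (detU3 A)⁻¹ 1).1, Matrix.mem_specialUnitaryGroup_iff.2
    ⟨mul_mem A.2 (diag3 1 (detU3 A)⁻¹ 1).2, by
      rw [Matrix.det_mul, det_diag3, one_mul, mul_one]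
      change ((detU3 A : Circle) : ℂ) * _ = 1
      rw [← Circle.coe_mul, mul_inv_cancel, Circle.coe_one]⟩⟩

/-- On the circle inversion is conjugation, so the entries are polynomial in those of `A` and their
conjugates, with no division. -/
theorem retractSU3_apply (A : U3) (i j : Fin 3) :
    (retractSU3 A).1 i j = A.1 i j * ![1, star A.1.det, 1] j := by
  refine (Matrix.mul_diagonal _ _ _ _).trans ?_
  have h : (((detU3 A)⁻¹ : Circle) : ℂ) = star A.1.det := Circle.coe_inv_eq_conj _
  rw [h, Circle.coe_one]

theorem continuous_retractSU3 : Continuous retractSU3 := by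
  refine continuous_induced_rng.2 (continuous_matrix fun i j => ?_)
  change Continuous fun A => (retractSU3 A).1 i j
  simp only [retractSU3_apply]
  have hdet : Continuous fun A : U3 => A.1.det := continuous_subtype_val.matrix_det
  refine (continuous_subtype_val.matrix_elem i j).mul ?_
  fin_cases j
  · exact continuous_const
  · exact hdet.star
  · exact continuous_const

theorem dSmooth_retractSU3 : DSmooth retractSU3 := by
  intro n p hp
  rw [isPlot_matrix_iff] at hp ⊢
  intro i j
  simp only [Function.comp_apply, retractSU3_apply]
  refine (hp i j).mul ?_
  fin_cases j
  · exact contDiff_const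
  -- Conjugation is real-linear, hence smooth over `ℝ`.
  · change ContDiff ℝ ∞ fun x => Complex.conjCLE (p x).1.det
    refine Complex.conjCLE.contDiff.comp ?_
    simp only [Matrix.det_fin_three]
    fun_prop
  · exact contDiff_const

/-! ### Comparison of the orbits -/

variable (p₁ p₂ p₃ : ℤ)

/-- The projection of `SU(3)` onto the twistor space. -/
noncomputable def twistorMk : SU3 → Twistor p₁ p₂ p₃ :=
  OrbitSpace.mk (characteristicAction p₁ p₂ p₃) ∘ OrbitSpace.mk (sasakianAction p₁ p₂ p₃)

theorem isSmoothQuotientMap_twistorMk : IsSmoothQuotientMap (twistorMk p₁ p₂ p₃) :=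
  (OrbitSpace.isSmoothQuotientMap_mk _).comp (OrbitSpace.isSmoothQuotientMap_mk _)

theorem torus2_mk_eq_iff (A B : SU3) :
    OrbitSpace.mk (torus2Action p₁ p₂ p₃) A = OrbitSpace.mk (torus2Action p₁ p₂ p₃) B ↔
      ∃ z u : Circle, (diag3 (z ^ p₁) (z ^ p₂) (z ^ p₃)).1 * B.1 *
        (diag3 u u⁻¹ (z ^ (-p₁ - p₂ - p₃))).1 = A.1 := by
  rw [OrbitSpace.mk_eq_mk_iff, Prod.exists]
  exact exists₂_congr fun _ _ => Subtype.ext_iff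

theorem twistorMk_eq_iff (A B : SU3) :
    twistorMk p₁ p₂ p₃ A = twistorMk p₁ p₂ p₃ B ↔
      ∃ z u : Circle, (diag3 (z ^ p₁) (z ^ p₂) (z ^ p₃)).1 * B.1 *
        (diag3 u u⁻¹ (z ^ (-p₁ - p₂ - p₃))).1 = A.1 := by
  refine OrbitSpace.mk_eq_mk_iff.trans ?_
  rw [exists_comm]
  refine exists_congr fun u => ?_
  change OrbitSpace.mk (sasakianAction p₁ p₂ p₃) (B * blockSU2 (torusSU2 u)) =
    OrbitSpace.mk (sasakianAction p₁ p₂ p₃) A ↔ _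
  -- The equality is flipped so that `z` acts on the translate of `B`, as on the right-hand side.
  rw [eq_comm, OrbitSpace.mk_eq_mk_iff]
  refine exists_congr fun z => Subtype.ext_iff.trans ?_
  change (diag3 _ _ _).1 * (B.1 * (blockSU2 (torusSU2 u)).1) *
    (diag3 1 1 (z ^ (-p₁ - p₂ - p₃))).1 = A.1 ↔ _
  have h : (diag3 u u⁻¹ 1).1 * (diag3 1 1 (z ^ (-p₁ - p₂ - p₃))).1 =
      (diag3 u u⁻¹ (z ^ (-p₁ - p₂ - p₃))).1 := by
    rw [← Matrix.UnitaryGroup.mul_val, ← diag3_mul]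
    simp only [mul_one, one_mul]
  rw [blockSU2_torusSU2, ← h]
  simp only [mul_assoc]

/-- Scalars can be moved between the two diagonal factors. -/
theorem diag3_mul_mul_diag3_scalar (w a b c d e f : Circle) (A : Matrix (Fin 3) (Fin 3) ℂ) :
    (diag3 (w * a) (w * b) (w * c)).1 * A * (diag3 d e f).1 =
      (diag3 a b c).1 * A * (diag3 (w * d) (w * e) (w * f)).1 := by
  ext i j
  simp only [diag3, Matrix.mul_diagonal, Matrix.diagonal_mul]
  fin_cases i <;> fin_cases j <;> simp <;> ring

/-- Since `-p₂ - p₃ = (-p₁ - p₂ - p₃) + p₁`, and likewise for the other two exponents, a common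
scalar splits off the left factor. -/
theorem torus3_smul_val (z u v : Circle) (A : U3) :
    ((torus3Action p₁ p₂ p₃).smul (z, u, v) A).1 =
      (diag3 (z ^ p₁) (z ^ p₂) (z ^ p₃)).1 * A.1 *
        (diag3 (z ^ (-p₁ - p₂ - p₃) * u) (z ^ (-p₁ - p₂ - p₃) * v) (z ^ (-p₁ - p₂ - p₃))).1 := by
  change (diag3 _ _ _).1 * A.1 * (diag3 u v 1).1 = _
  have h := diag3_mul_mul_diag3_scalar (z ^ (-p₁ - p₂ - p₃)) (z ^ p₁) (z ^ p₂) (z ^ p₃) u v 1 A.1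
  rw [mul_one] at h
  rw [← h]
  simp only [← zpow_add]
  ring_nf

theorem torus3_mk_inclU3_eq_iff (A B : SU3) :
    OrbitSpace.mk (torus3Action p₁ p₂ p₃) (inclU3 A) =
        OrbitSpace.mk (torus3Action p₁ p₂ p₃) (inclU3 B) ↔
      ∃ z u : Circle, (diag3 (z ^ p₁) (z ^ p₂) (z ^ p₃)).1 * B.1 *
        (diag3 u u⁻¹ (z ^ (-p₁ - p₂ - p₃))).1 = A.1 := by
  rw [OrbitSpace.mk_eq_mk_iff]
  constructor
  · rintro ⟨⟨z, u, v⟩, h⟩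
    have h' := congrArg Subtype.val h
    rw [torus3_smul_val] at h'
    change (diag3 _ _ _).1 * B.1 * (diag3 _ _ _).1 = A.1 at h'
    set s := z ^ (-p₁ - p₂ - p₃) with hs
    -- The first right-hand entry once the scalar `s` has been moved; determinants will identify the
    -- second, `s * v`, with its inverse.
    refine ⟨z, s * u, ?_⟩
    have hdet := congrArg Matrix.det h'
    rw [Matrix.det_mul, Matrix.det_mul, det_diag3, det_diag3,
      (Matrix.mem_specialUnitaryGroup_iff.1 A.2).2, (Matrix.mem_specialUnitaryGroup_iff.1 B.2).2,
      mul_one, ← Circle.coe_mul, ← Circle.coe_one, Circle.coe_inj] at hdet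
    have hz : z ^ p₁ * z ^ p₂ * z ^ p₃ * s = 1 := by
      rw [hs]
      simp only [← zpow_add]
      ring_nf
      simp
    have hsv : (s * u)⁻¹ = s * v := by
      rw [inv_eq_iff_mul_eq_one]
      calc s * u * (s * v) = z ^ p₁ * z ^ p₂ * z ^ p₃ * s * (s * u * (s * v)) := by
            rw [hz, one_mul]
        _ = z ^ p₁ * z ^ p₂ * z ^ p₃ * (s * u * (s * v) * s) := by
            simp only [mul_comm, mul_left_comm]
        _ = 1 := hdet
    rw [hsv, h']
  · rintro ⟨z, u, h⟩
    refine ⟨(z, (z ^ (-p₁ - p₂ - p₃))⁻¹ * u, (z ^ (-p₁ - p₂ - p₃))⁻¹ * u⁻¹), Subtype.ext ?_⟩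
    rw [torus3_smul_val, mul_inv_cancel_left, mul_inv_cancel_left]
    exact h

theorem torus3_mk_inclU3_retractSU3 (A : U3) :
    OrbitSpace.mk (torus3Action p₁ p₂ p₃) (inclU3 (retractSU3 A)) =
      OrbitSpace.mk (torus3Action p₁ p₂ p₃) A := by
  -- At `z = u = 1` the action is right multiplication by `diag(1, v, 1)`, so the retraction is
  -- itself a translation within the orbit.
  refine OrbitSpace.mk_eq_mk_iff.2 ⟨(1, 1, (detU3 A)⁻¹), Subtype.ext ?_⟩
  rw [torus3_smul_val]
  simp only [one_zpow, diag3_one, one_mul]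
  exact congrArg (· * (diag3 1 (detU3 A)⁻¹ 1).1) (one_mul A.1)

theorem diffeomorphic_torus2 : Diffeomorphic (Twistor p₁ p₂ p₃)
    (OrbitSpace (torus2Action p₁ p₂ p₃)) :=
  (isSmoothQuotientMap_twistorMk p₁ p₂ p₃).diffeomorphic (OrbitSpace.isSmoothQuotientMap_mk _)
    continuous_id dSmooth_id continuous_id dSmooth_id
    (fun A B => (torus2_mk_eq_iff p₁ p₂ p₃ A B).trans (twistorMk_eq_iff p₁ p₂ p₃ A B).symm)
    fun _ => rfl

theorem diffeomorphic_torus3 : Diffeomorphic (Twistor p₁ p₂ p₃)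
    (OrbitSpace (torus3Action p₁ p₂ p₃)) :=
  (isSmoothQuotientMap_twistorMk p₁ p₂ p₃).diffeomorphic (OrbitSpace.isSmoothQuotientMap_mk _)
    continuous_inclU3 dSmooth_inclU3 continuous_retractSU3 dSmooth_retractSU3
    (fun A B => (torus3_mk_inclU3_eq_iff p₁ p₂ p₃ A B).trans (twistorMk_eq_iff p₁ p₂ p₃ A B).symm)
    (torus3_mk_inclU3_retractSU3 p₁ p₂ p₃)

end TwistorSpace

theorem mainTheorem2 (p₁ p₂ p₃ : ℤ) (h₁ : 0 < p₁) (h₂ : 0 < p₂) (h₃ : 0 < p₃)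
    (h₁₂ : IsCoprime p₁ p₂) (h₁₃ : IsCoprime p₁ p₃) (h₂₃ : IsCoprime p₂ p₃) :
    TwistorSpace.Diffeomorphic (TwistorSpace.Twistor p₁ p₂ p₃)
        (TwistorSpace.OrbitSpace (TwistorSpace.torus2Action p₁ p₂ p₃)) ∧
      TwistorSpace.Diffeomorphic (TwistorSpace.Twistor p₁ p₂ p₃)
        (TwistorSpace.OrbitSpace (TwistorSpace.torus3Action p₁ p₂ p₃)) :=
  ⟨TwistorSpace.diffeomorphic_torus2 p₁ p₂ p₃, TwistorSpace.diffeomorphic_torus3 p₁ p₂ p₃⟩
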